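/- A hexagonal chain with $n$ hexagons is a sequence of $n$ distinct cells of the hexagonal lattice in which two cells share an edge exactly if they are consecutive. A lucasene with $n$ hexagons is a hexagonal chain in which, when numbered from a suitable end, three consecutive hexagons are linearly attached exactly if they are the first three ones (for $n\le 2$: any hexagonal chain with $n$ hexagons). Colour the vertices of the lattice properly black and white; the directed inner dual graph of the chain has the hexagons as vertices and, for every pair of adjacent hexagons, an arc crossing their common edge with the black end of that edge on its left. An L-fence $\Xi_n$ is a poset whose Hasse diagram (arcs pointing from an element to the elements it covers) is isomorphic to the directed inner dual graph of a lucasene with $n$ hexagons; so, up to isomorphism and duality, $\Xi_n$ is the poset $x_1>x_2>x_3<x_4>x_5<\cdots$ on $n$ elements. The matchable Lucas cube $\Omega_n$ ($n\ge 0$) is the undirected Hasse diagram of the lattice of all filters (up-sets) of $\Xi_n$ ordered by reverse inclusion; $\Omega_0$ is a single vertex. Let $h_{n,k}$ be the number of maximal induced $k$-dimensional cubes of $\Omega_n$, i.e. of vertex sets that induce a $k$-dimensional hypercube and are not properly contained in a vertex set inducing a hypercube (of any dimension), with $h_{n,-1}=0$, and let $H_n(x)=\sum_{k\ge 0}h_{n,k}x^k$.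 Let $p'_0=1$, $p'_1=2$, $p'_2=3$ and $p'_n=p'_{n-2}+p'_{n-3}$ for $n\ge 3$ (the $(1,2,3)$-Padovan numbers). Theorem. For all $n\ge 5$ and $k\ge 0$, \[ h_{n,k}=h_{n-2,k-1}+h_{n-3,k-1}. \] Moreover, as formal power series in $y$ over $\mathbb Z[x]$ and over $\mathbb Z$ respectively, \[ \sum_{n\ge 0}H_n(x)\,y^n=\frac{2+y}{1-xy^2(1+y)}-(1-x)y-1, \qquad \sum_{n\ge 0}p'_n\,y^n=\frac{1+2y+2y^2}{1-y^2-y^3}. \] -/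

import Mathlib

/-! ### Hexagonal chains and lucasenes

The cells of the hexagonal lattice are indexed by axial coordinates in `ℤ × ℤ`. -/

/-- The six vectors leading from a cell to its neighbours, in counterclockwise order. -/
def hexDir : Fin 6 → ℤ × ℤ :=
  ![(1, 0), (0, 1), (-1, 1), (-1, 0), (0, -1), (1, -1)]

/-- Two hexagons share an edge. -/
def HexAdj (c d : ℤ × ℤ) : Prop := ∃ i : Fin 6, d = c + hexDir i

/-- The arc of the directed inner dual graph from the hexagon `c` to the hexagon `d`.  The vertices
of the hexagonal lattice are properly coloured black and white; the arc that crosses the common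
edge of two adjacent hexagons is directed so that the black end of this edge lies on its left.
The colours alternate along the boundary of a hexagon, hence the arcs across the six edges of a
hexagon leave and enter it alternately. -/
def HexArc (c d : ℤ × ℤ) : Prop := ∃ i : Fin 6, Even (i : ℕ) ∧ d = c + hexDir i

/-- A hexagonal chain with `n` hexagons: the hexagons `c 0, …, c (n - 1)` are distinct, and two of
them share an edge exactly if they are consecutive. -/
structure IsHexChain {n : ℕ} (c : Fin n → ℤ × ℤ) : Prop where
  injective : Function.Injective c
  adj_iff : ∀ i j : Fin n,
    HexAdj (c i) (c j) ↔ (i : ℕ) + 1 = (j : ℕ) ∨ (j : ℕ) + 1 = (i : ℕ)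

/-- A lucasene with `n` hexagons: a hexagonal chain, numbered from a suitable end, in which three
consecutive hexagons are linearly attached exactly if they are the first three ones.
For `n ≤ 2` this is just a hexagonal chain with `n` hexagons. -/
structure IsLucasene {n : ℕ} (c : Fin n → ℤ × ℤ) : Prop extends IsHexChain c where
  linear_iff : ∀ i j k : Fin n, (j : ℕ) = i + 1 → (k : ℕ) = i + 2 →
    (c k - c j = c j - c i ↔ (i : ℕ) = 0)

/-! ### L-fences and matchable Lucas cubes -/

/-- `P` is an L-fence `Ξ_n`: its Hasse diagram (arcs lead from an element to the elements that it
covers) is isomorphic to the directed inner dual graph of a lucasene with `n` hexagons. -/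
def IsLFence (n : ℕ) (P : Type*) [PartialOrder P] : Prop :=
  ∃ (c : Fin n → ℤ × ℤ) (e : P ≃ Fin n), IsLucasene c ∧
    ∀ a b : P, b ⋖ a ↔ HexArc (c (e a)) (c (e b))

/-- The undirected Hasse diagram of the filter lattice of `P`; for an L-fence `P = Ξ_n` this is the
matchable Lucas cube `Ω_n`.  `UpperSet P` consists of all filters of `P`, ordered by
reverse inclusion. -/
def filterCube (P : Type*) [PartialOrder P] : SimpleGraph (UpperSet P) :=
  SimpleGraph.hasse (UpperSet P)

/-! ### Maximal cube polynomials -/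

/-- The `k`-dimensional cube. -/
def cubeGraph (k : ℕ) : SimpleGraph (Fin k → Bool) where
  Adj u v := hammingDist u v = 1
  symm := ⟨fun u v h => by rwa [hammingDist_comm]⟩
  loopless := ⟨fun u h => by simp at h⟩

/-- The vertex set `S` induces a `k`-dimensional cube in `G`. -/
def InducesCube {V : Type*} (G : SimpleGraph V) (k : ℕ) (S : Set V) : Prop :=
  Nonempty (G.induce S ≃g cubeGraph k)

/-- The vertex set `S` induces a `k`-dimensional cube in `G` that is not properly contained in
another induced cube of `G`. -/
def InducesMaximalCube {V : Type*} (G : SimpleGraph V) (k : ℕ) (S : Set V) : Prop :=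
  InducesCube G k S ∧ ∀ (m : ℕ) (T : Set V), InducesCube G m T → S ⊆ T → T = S

/-- The number `h_k(G)` of maximal induced `k`-dimensional cubes in the finite graph `G`. -/
noncomputable def numMaximalCubes {V : Type*} (G : SimpleGraph V) (k : ℕ) : ℕ :=
  {S : Set V | InducesMaximalCube G k S}.ncard

/-- The maximal cube polynomial `∑_{k ≥ 0} h_k(G) x ^ k` of the finite graph `G`. -/
noncomputable def maximalCubePoly {V : Type*} (G : SimpleGraph V) : Polynomial ℤ :=
  ∑ᶠ k : ℕ, Polynomial.C (numMaximalCubes G k : ℤ) * Polynomial.X ^ k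

/-- The `(1,2,3)`-Padovan numbers. -/
def padovan123 : ℕ → ℕ
  | 0 => 1
  | 1 => 2
  | 2 => 3
  | n + 3 => padovan123 (n + 1) + padovan123 n

/-! ### L-fences exist for every `n` -/

/-- The rank of the `i`-th element (counted from `0`) of the poset
`x₀ > x₁ > x₂ < x₃ > x₄ < ⋯`. -/
def fenceHeight (i : ℕ) : ℕ := if i = 0 then 2 else i % 2

/-- The poset `x₀ > x₁ > x₂ < x₃ > x₄ < ⋯` with `n` elements. -/
structure StdFence (n : ℕ) where
  idx : Fin n

/-- The order of the poset `x₀ > x₁ > x₂ < x₃ > x₄ < ⋯`. -/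
instance (n : ℕ) : PartialOrder (StdFence n) where
  le a b := (a.idx : ℕ) = b.idx ∨ (fenceHeight a.idx < fenceHeight b.idx ∧
    ((a.idx : ℕ) + 1 = b.idx ∨ (b.idx : ℕ) + 1 = a.idx ∨ ((a.idx : ℕ) = 2 ∧ (b.idx : ℕ) = 0)))
  le_refl a := Or.inl rfl
  le_trans a b c := by
    simp only [fenceHeight]
    split_ifs <;> omega
  le_antisymm a b h1 h2 := by
    obtain ⟨⟨a, ha⟩⟩ := a
    obtain ⟨⟨b, hb⟩⟩ := b
    simp only [StdFence.mk.injEq, Fin.mk.injEq] at *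
    omega

theorem StdFence.lt_iff {n : ℕ} (a b : StdFence n) :
    a < b ↔ (fenceHeight a.idx < fenceHeight b.idx ∧
    ((a.idx : ℕ) + 1 = b.idx ∨ (b.idx : ℕ) + 1 = a.idx ∨
      ((a.idx : ℕ) = 2 ∧ (b.idx : ℕ) = 0))) := by
  rw [lt_iff_le_not_ge]
  change ((a.idx : ℕ) = b.idx ∨ (_ ∧ _)) ∧ ¬ ((b.idx : ℕ) = a.idx ∨ (_ ∧ _)) ↔ _
  constructor
  · rintro ⟨h | h, h'⟩
    · omega
    · exact h
  · intro h
    refine ⟨Or.inr h, ?_⟩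
    rintro (h' | h')
    · rw [h'] at h
      omega
    · omega

theorem StdFence.covBy_iff {n : ℕ} (a b : StdFence n) :
    a ⋖ b ↔ (fenceHeight a.idx < fenceHeight b.idx ∧
      ((a.idx : ℕ) + 1 = b.idx ∨ (b.idx : ℕ) + 1 = a.idx)) := by
  constructor
  · rintro ⟨h, h'⟩
    rw [StdFence.lt_iff] at h
    refine ⟨h.1, ?_⟩
    rcases h.2 with h2 | h2 | ⟨h2, h3⟩
    · exact Or.inl h2
    · exact Or.inr h2
    · exfalso
      have hn : 1 < n := by have := a.idx.2; omega
      refine @h' ⟨⟨1, hn⟩⟩ ?_ ?_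
      · rw [StdFence.lt_iff]; simp [h2, fenceHeight]
      · rw [StdFence.lt_iff]; simp [h3, fenceHeight]
  · rintro ⟨h, h'⟩
    refine ⟨(StdFence.lt_iff a b).2 ⟨h, by omega⟩, ?_⟩
    intro c h1 h2
    rw [StdFence.lt_iff] at h1 h2
    simp only [fenceHeight] at *
    split_ifs at * <;> omega

/-- A zigzag lucasene. -/
def stdLucasene (n : ℕ) (i : Fin n) : ℤ × ℤ :=
  if (i : ℕ) = 0 then (-1, 0) else (((i : ℕ) / 2 : ℕ), (((i : ℕ) - 1) / 2 : ℕ))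

theorem hexAdj_iff (c d : ℤ × ℤ) : HexAdj c d ↔
    (d.1 = c.1 + 1 ∧ d.2 = c.2) ∨ (d.1 = c.1 ∧ d.2 = c.2 + 1) ∨
    (d.1 = c.1 - 1 ∧ d.2 = c.2 + 1) ∨ (d.1 = c.1 - 1 ∧ d.2 = c.2) ∨
    (d.1 = c.1 ∧ d.2 = c.2 - 1) ∨ (d.1 = c.1 + 1 ∧ d.2 = c.2 - 1) := by
  simp [HexAdj, hexDir, Fin.exists_fin_succ, Prod.ext_iff, sub_eq_add_neg]

theorem hexArc_iff (c d : ℤ × ℤ) : HexArc c d ↔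
    (d.1 = c.1 + 1 ∧ d.2 = c.2) ∨ (d.1 = c.1 - 1 ∧ d.2 = c.2 + 1) ∨
    (d.1 = c.1 ∧ d.2 = c.2 - 1) := by
  have e1 : ¬ Even 1 := by decide
  have e3 : ¬ Even 3 := by decide
  have e5 : ¬ Even 5 := by decide
  have e2 : Even 2 := by decide
  have e4 : Even 4 := by decide
  simp [HexArc, hexDir, Fin.exists_fin_succ, Prod.ext_iff, sub_eq_add_neg, e1, e2, e3, e4, e5]

theorem isLucasene_stdLucasene (n : ℕ) : IsLucasene (stdLucasene n) where
  injective i j h := by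
    simp only [stdLucasene] at h
    ext
    split_ifs at h <;> simp only [Prod.mk.injEq] at h <;> omega
  adj_iff i j := by
    rw [hexAdj_iff]
    simp only [stdLucasene]
    split_ifs <;> simp only [] <;> omega
  linear_iff i j k hj hk := by
    simp only [stdLucasene, Prod.ext_iff, Prod.fst_sub, Prod.snd_sub]
    split_ifs <;> simp only [] <;> omega

/-- There is an L-fence for every number of hexagons. -/
theorem isLFence_stdFence (n : ℕ) : IsLFence n (StdFence n) := by
  refine ⟨stdLucasene n, ⟨StdFence.idx, StdFence.mk, fun _ => rfl, fun _ => rfl⟩,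
    isLucasene_stdLucasene n, fun a b => ?_⟩
  rw [StdFence.covBy_iff, hexArc_iff]
  simp only [stdLucasene, fenceHeight, Equiv.coe_fn_mk]
  split_ifs <;> simp only [] <;> omega

/-!
Toggling an element of a poset in or out of a filter moves along an edge of the filter lattice, and
the opposite edges of a square toggle the same element. Hence an induced cube consists of the
filters obtained from one filter by independently toggling the elements of a set `A`, and `A` is
then an antichain. The cube can be enlarged unless `A` is a maximal antichain, and a maximal
antichain `A` determines the cube, so `h_{n,k}` counts the maximal antichains with `k` elements.

These are the maximal independent sets of the comparability graph, which for an L-fence is a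
triangle with a pendant path. The closed neighbourhood of the last vertex `v` of the path is a
clique, so a maximal independent set contains exactly one of `v` and its neighbour; deleting the
closed neighbourhood of that vertex leaves a shorter graph of the same kind, whence
`H_n = x (H_{n-2} + H_{n-3})`.
-/

open scoped symmDiff

/-! ### Induced cubes -/

theorem cubeGraph_adj_iff {k : ℕ} {u v : Fin k → Bool} :
    (cubeGraph k).Adj u v ↔ ∃ i, {j | u j = true} ∆ {j | v j = true} = {i} := by
  change hammingDist u v = 1 ↔ _
  simp only [hammingDist, Finset.card_eq_one, Finset.ext_iff, Set.ext_iff, Set.mem_symmDiff,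
    Finset.mem_filter, Finset.mem_univ, true_and, Finset.mem_singleton, Set.mem_ofPred_eq,
    Set.mem_singleton_iff]
  refine exists_congr fun i => forall_congr' fun j => ?_
  cases u j <;> cases v j <;> simp

theorem inducesCube_iff {V : Type*} {G : SimpleGraph V} {k : ℕ} {S : Set V} :
    InducesCube G k S ↔ ∃ g : Set (Fin k) → V, Function.Injective g ∧ Set.range g = S ∧
      ∀ s t, G.Adj (g s) (g t) ↔ ∃ i, s ∆ t = {i} := by
  classical
  let indicator : Set (Fin k) ≃ (Fin k → Bool) :=
    ⟨fun s i => decide (i ∈ s), fun v => {i | v i = true}, fun s => by simp, fun v => by simp⟩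
  have adj_indicator (s t) :
      (cubeGraph k).Adj (indicator s) (indicator t) ↔ ∃ i, s ∆ t = {i} := by
    simp [cubeGraph_adj_iff, indicator]
  constructor
  · rintro ⟨φ⟩
    refine ⟨fun s => φ.symm (indicator s), ?_, ?_, fun s t => ?_⟩
    · exact Subtype.val_injective.comp (φ.symm.injective.comp indicator.injective)
    · change Set.range (Subtype.val ∘ (φ.symm ∘ indicator)) = S
      rw [(φ.symm.surjective.comp indicator.surjective).range_comp, Subtype.range_coe]
    · rw [← adj_indicator, ← φ.symm.map_adj_iff, SimpleGraph.induce_adj]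
  · rintro ⟨g, hg, rfl, hadj⟩
    let e := (Equiv.ofInjective g hg).symm.trans indicator
    refine ⟨⟨e, fun {x y} => ?_⟩⟩
    obtain ⟨⟨-, s, rfl⟩, ⟨-, t, rfl⟩⟩ := x, y
    simp [e, adj_indicator, hadj]

theorem InducesCube.ncard_eq {V : Type*} {G : SimpleGraph V} {k : ℕ} {S : Set V}
    (h : InducesCube G k S) : S.ncard = 2 ^ k := by
  obtain ⟨φ⟩ := h
  rw [← Nat.card_coe_set_eq, Nat.card_congr φ.toEquiv]
  simp

theorem eq_of_symmDiff_square {α : Type*} {s t u v : Set α} {a b c d : α} (hts : t ∆ s = {a})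
    (hus : u ∆ s = {b}) (hvu : v ∆ u = {c}) (hvt : v ∆ t = {d}) (hvs : v ≠ s) (htu : t ≠ u) :
    c = a := by
  have hba : b ≠ a := by
    rintro rfl
    exact htu (symmDiff_left_injective s (hts.trans hus.symm))
  have hda : d ≠ a := by
    rintro rfl
    exact hvs (symmDiff_left_injective t (hvt.trans (symmDiff_comm s t ▸ hts).symm))
  have hcycle : ({c} ∆ {b} : Set α) = {d} ∆ {a} := by
    rw [← hvu, ← hus, ← hvt, ← hts]
    simp only [symmDiff_assoc, symmDiff_symmDiff_cancel_left]
  have ha : a ∈ ({c} ∆ {b} : Set α) := hcycle ▸ Or.inr ⟨rfl, hda.symm⟩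
  exact (ha.resolve_right fun h => hba h.1.symm).1.symm

theorem symmDiff_insert_eq_symmDiff_singleton {ι P : Type*} [Finite ι] {g : Set ι → Set P}
    (hinj : Function.Injective g) (hadj : ∀ s t, (∃ i, s ∆ t = {i}) → ∃ p, g s ∆ g t = {p})
    (s : Set ι) : ∀ i ∉ s, g (insert i s) ∆ g s = g {i} ∆ g ∅ := by
  have hinsert {s : Set ι} {i : ι} (hi : i ∉ s) : ∃ p, g (insert i s) ∆ g s = {p} :=
    hadj _ _ ⟨i, by rw [symmDiff_of_ge (Set.subset_insert i s), Set.sdiff_eq]; grind⟩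
  induction s, s.toFinite using Set.Finite.induction_on with
  | empty => intro i _; rw [insert_empty_eq]
  | @insert j s hj _ ih =>
    intro i hi
    have hij : i ≠ j := fun h => hi (h ▸ Set.mem_insert i s)
    have his : i ∉ s := fun h => hi (Set.mem_insert_of_mem j h)
    obtain ⟨a, ha⟩ := hinsert hi
    obtain ⟨b, hb⟩ := hinsert (s := insert i s) (i := j) (by grind)
    obtain ⟨c, hc⟩ := hinsert his
    obtain ⟨d, hd⟩ := hinsert hj
    have hne_far : g (insert i (insert j s)) ≠ g s := fun h => his (hinj h ▸ Set.mem_insert _ _)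
    have hne_mid : g (insert i s) ≠ g (insert j s) := fun h => hi (hinj h ▸ Set.mem_insert i s)
    rw [Set.insert_comm] at hb
    rw [← ih i his, hc, ha, eq_of_symmDiff_square hc hd ha hb hne_far hne_mid]

theorem exists_injective_eq_symmDiff_image {ι P : Type*} [Finite ι] {g : Set ι → Set P}
    (hinj : Function.Injective g)
    (hadj : ∀ s t, (∃ i, s ∆ t = {i}) → ∃ p, g s ∆ g t = {p}) :
    ∃ z : ι → P, Function.Injective z ∧ ∀ s, g s = g ∅ ∆ (z '' s) := by
  choose z hz using fun i : ι => hadj {i} ∅ ⟨i, symmDiff_bot _⟩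
  have hz_inj : Function.Injective z := fun i j hij => by
    have h := (hz i).trans ((congrArg _ hij).trans (hz j).symm)
    simpa using hinj (symmDiff_left_injective _ h)
  refine ⟨z, hz_inj, fun s => ?_⟩
  induction s, s.toFinite using Set.Finite.induction_on with
  | empty => rw [Set.image_empty]; exact (symmDiff_bot _).symm
  | @insert i s hi _ ih =>
    have hzi : z i ∉ z '' s := fun h => hi (hz_inj.mem_set_image.1 h)
    have hsum : z '' insert i s = (z '' s) ∆ {z i} := by
      rw [Set.image_insert_eq]; grind
    rw [hsum, ← symmDiff_assoc, ← ih, ← hz,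
      ← symmDiff_insert_eq_symmDiff_singleton hinj hadj s i hi, symmDiff_comm (g s),
      symmDiff_symmDiff_cancel_right]

theorem covBy_or_covBy_iff_symmDiff {α : Type*} {s t : Set α} :
    s ⋖ t ∨ t ⋖ s ↔ ∃ a, s ∆ t = {a} := by
  simp only [Set.covBy_iff_exists_insert]
  constructor
  · rintro (⟨a, ha, rfl⟩ | ⟨a, ha, rfl⟩) <;> refine ⟨a, ?_⟩ <;> ext b <;>
      simp only [Set.mem_symmDiff, Set.mem_insert_iff, Set.mem_singleton_iff] <;> grind
  · rintro ⟨a, h⟩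
    simp only [Set.ext_iff, Set.mem_symmDiff, Set.mem_singleton_iff, Set.mem_insert_iff] at h ⊢
    by_cases ha : a ∈ s
    · exact Or.inr ⟨a, by grind, by grind⟩
    · exact Or.inl ⟨a, ha, by grind⟩

theorem isMaxAntichain_iff {α : Type*} {r : α → α → Prop} {s : Set α} :
    IsMaxAntichain r s ↔ IsAntichain r s ∧ ∀ p ∉ s, ∃ a ∈ s, r a p ∨ r p a := by
  refine and_congr_right fun hs => ⟨fun h p hp => ?_, fun h t ht hst => ?_⟩
  · by_contra! hcon
    have hins := hs.insert (a := p) (fun a ha _ => (hcon a ha).1) (fun a ha _ => (hcon a ha).2)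
    exact hp (h hins (Set.subset_insert p s) ▸ Set.mem_insert p s)
  · refine hst.antisymm fun p hp => by_contra fun hps => ?_
    obtain ⟨a, ha, hap | hpa⟩ := h p hps
    · exact ht (hst ha) hp (fun e => hps (e ▸ ha)) hap
    · exact ht hp (hst ha) (fun e => hps (e ▸ ha)) hpa

section Toggling

variable {P : Type*} [PartialOrder P] {F G : UpperSet P} {A B : Set P} {k : ℕ}

theorem upperSet_covBy_iff [Finite P] : F ⋖ G ↔ (G : Set P) ⋖ F := by
  constructor
  · intro h
    obtain ⟨p, ⟨hpF, hpG⟩, hp⟩ :=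
      (Set.toFinite ((F : Set P) \ G)).exists_maximal (Set.sdiff_nonempty.2 h.lt.not_ge)
    have hupper : IsUpperSet (insert p (G : Set P)) := by
      rintro a b hab (rfl | ha)
      · by_cases hb : b ∈ G
        · exact Or.inr hb
        · exact Or.inl ((hp ⟨F.upper hab hpF, hb⟩ hab).antisymm hab)
      · exact Or.inr (G.upper hab ha)
    have hF : (⟨insert p G, hupper⟩ : UpperSet P) = F :=
      (h.eq_or_eq (c := ⟨insert p G, hupper⟩) (Set.insert_subset hpF h.le)
        (Set.subset_insert p G)).resolve_right fun e => hpG (e ▸ Set.mem_insert p (G : Set P))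
    exact Set.covBy_iff_exists_insert.2 ⟨p, hpG, congrArg SetLike.coe hF⟩
  · exact fun h => ⟨h.lt, fun K hFK hKG => h.2 hKG hFK⟩

theorem filterCube_adj_iff [Finite P] :
    (filterCube P).Adj F G ↔ ∃ p, (F : Set P) ∆ G = {p} := by
  rw [filterCube, SimpleGraph.hasse_adj, upperSet_covBy_iff, upperSet_covBy_iff, or_comm,
    covBy_or_covBy_iff_symmDiff]

/-- The elements of `A` can be toggled independently in the filter `F`: changing the membership of
some of them always yields a filter. -/
def IndepToggleable (F : UpperSet P) (A : Set P) : Prop :=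
  ∀ U : Set P, U ∆ F ⊆ A → IsUpperSet U

/-- The filters that arise from the filter `F` by toggling elements of `A`. If the elements of `A`
can be toggled independently, they form an induced cube of `filterCube P`. -/
def toggleCube (F : UpperSet P) (A : Set P) : Set (UpperSet P) :=
  {G | (G : Set P) ∆ F ⊆ A}

theorem indepToggleable_iff : IndepToggleable F A ↔
    ∀ ⦃a b⦄, a < b → a ∈ (F : Set P) ∪ A → b ∈ (F : Set P) \ A := by
  constructor
  · intro h a b hab ha
    have hb : b ∈ ((F : Set P) ∪ {a}) \ (A ∩ {b}) := by
      refine h _ (fun p hp => ?_) hab.le ⟨Or.inr rfl, fun hb => hab.ne hb.2⟩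
      grind
    grind [hab.ne]
  · intro h U hU a b hab ha
    rcases hab.eq_or_lt with rfl | hab
    · exact ha
    · have := h hab
      have hUa := @hU a
      have hUb := @hU b
      grind

theorem IndepToggleable.isAntichain (h : IndepToggleable F A) : IsAntichain (· ≤ ·) A :=
  isAntichain_iff_forall_not_lt.2 fun _ ha _ hb hab =>
    (indepToggleable_iff.1 h hab (Or.inr ha)).2 hb

theorem IndepToggleable.toggleCube_subset_iff (h : IndepToggleable F A) :
    toggleCube F A ⊆ toggleCube G B ↔ A ⊆ B ∧ (F : Set P) ∆ G ⊆ B := by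
  constructor
  · intro hsub
    have hFG : (F : Set P) ∆ G ⊆ B := @hsub F (by simp [toggleCube])
    have hA : ((F : Set P) ∆ A) ∆ F ⊆ A := by rw [symmDiff_comm _ A, symmDiff_symmDiff_cancel_right]
    have hAG : ((F : Set P) ∆ A) ∆ G ⊆ B := @hsub ⟨F ∆ A, h _ hA⟩ hA
    refine ⟨fun a ha => ?_, hFG⟩
    grind
  · rintro ⟨hAB, hFG⟩ K hK
    exact (symmDiff_triangle _ (F : Set P) _).trans (sup_le (hK.trans hAB) hFG)

theorem IndepToggleable.inducesCube [Finite P] (h : IndepToggleable F A) (hA : A.ncard = k) :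
    InducesCube (filterCube P) k (toggleCube F A) := by
  obtain ⟨z, hz, rfl⟩ : ∃ z : Fin k → P, Function.Injective z ∧ Set.range z = A := by
    have e : Fin k ≃ A := (Finite.equivFinOfCardEq hA).symm
    exact ⟨_, Subtype.val_injective.comp e.injective,
      by rw [e.surjective.range_comp, Subtype.range_coe]⟩
  have toggle_cancel (s : Set (Fin k)) : ((F : Set P) ∆ (z '' s)) ∆ F = z '' s := by
    rw [symmDiff_comm _ (z '' s), symmDiff_symmDiff_cancel_right]
  refine inducesCube_iff.2 ⟨fun s => ⟨F ∆ (z '' s), h _ ?_⟩, ?_, ?_, ?_⟩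
  · exact (toggle_cancel s).trans_subset (Set.image_subset_range z s)
  · intro s t hst
    exact hz.image_injective (symmDiff_right_injective _ (congrArg SetLike.coe hst))
  · ext G
    constructor
    · rintro ⟨s, rfl⟩
      exact (toggle_cancel s).trans_subset (Set.image_subset_range z s)
    · intro hG
      obtain ⟨s, hs⟩ := Set.subset_range_iff_exists_image_eq.1 hG
      exact ⟨s, SetLike.coe_injective (by simp [hs, symmDiff_comm (G : Set P)])⟩
  · intro s t
    rw [filterCube_adj_iff]
    change (∃ p, ((F : Set P) ∆ (z '' s)) ∆ (F ∆ (z '' t)) = {p}) ↔ _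
    rw [symmDiff_symmDiff_symmDiff_comm, symmDiff_self, bot_symmDiff, ← Set.image_symmDiff hz]
    simp only [← Set.ncard_eq_one, Set.ncard_image_of_injective _ hz]

theorem inducesCube_filterCube_iff [Finite P] {S : Set (UpperSet P)} :
    InducesCube (filterCube P) k S ↔
      ∃ F A, IndepToggleable F A ∧ A.ncard = k ∧ toggleCube F A = S := by
  constructor
  · intro h
    obtain ⟨g, hg, rfl, hadj⟩ := inducesCube_iff.1 h
    obtain ⟨z, hz, hgz⟩ := exists_injective_eq_symmDiff_image
      (g := fun s => (g s : Set P)) (SetLike.coe_injective.comp hg)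
      fun s t hst => filterCube_adj_iff.1 ((hadj s t).2 hst)
    have hmem (U : Set P) (hU : U ∆ g ∅ ⊆ Set.range z) : ∃ s, (g s : Set P) = U := by
      obtain ⟨s, hs⟩ := Set.subset_range_iff_exists_image_eq.1 hU
      exact ⟨s, by rw [hgz, hs, symmDiff_comm U, symmDiff_symmDiff_cancel_left]⟩
    refine ⟨g ∅, Set.range z, fun U hU => ?_, ?_, ?_⟩
    · obtain ⟨s, rfl⟩ := hmem U hU
      exact (g s).upper
    · rw [← Set.image_univ, Set.ncard_image_of_injective _ hz, Set.ncard_univ, Nat.card_fin]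
    · ext G
      constructor
      · intro hG
        obtain ⟨s, hs⟩ := hmem G hG
        exact ⟨s, SetLike.coe_injective hs⟩
      · rintro ⟨s, rfl⟩
        change (g s : Set P) ∆ g ∅ ⊆ Set.range z
        rw [hgz s, symmDiff_comm _ (z '' s), symmDiff_symmDiff_cancel_right]
        exact Set.image_subset_range z s
  · rintro ⟨F, A, h, hA, rfl⟩
    exact h.inducesCube hA

theorem indepToggleable_upperClosure (hA : IsAntichain (· ≤ ·) A) :
    IndepToggleable (upperClosure A) A := by
  refine indepToggleable_iff.2 fun a b hab ha => ?_
  obtain ⟨c, hc, hca⟩ : a ∈ upperClosure A := ha.elim id fun h => subset_upperClosure h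
  have hcb := hca.trans_lt hab
  exact ⟨⟨c, hc, hcb.le⟩, fun hb => hA hc hb hcb.ne hcb.le⟩

theorem IndepToggleable.symmDiff_upperClosure_subset (h : IndepToggleable F A)
    (hA : IsMaxAntichain (· ≤ ·) A) : (F : Set P) ∆ upperClosure A ⊆ A := by
  intro p hp
  by_contra hpA
  rw [indepToggleable_iff] at h
  obtain ⟨a, ha, hap | hpa⟩ := (isMaxAntichain_iff.1 hA).2 p hpA
  · have hpF := (h (hap.lt_of_ne (ne_of_mem_of_not_mem ha hpA)) (Or.inr ha)).1
    exact hp.elim (fun hp => hp.2 ⟨a, ha, hap⟩) (fun hp => hp.2 hpF)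
  · have hpa := hpa.lt_of_ne (ne_of_mem_of_not_mem ha hpA).symm
    rcases hp with ⟨hpF, -⟩ | ⟨⟨c, hc, hcp⟩, -⟩
    · exact (h hpa (Or.inl hpF)).2 ha
    · exact hA.1 hc ha (hcp.trans_lt hpa).ne (hcp.trans hpa.le)

theorem IndepToggleable.toggleCube_eq (h : IndepToggleable F A)
    (hA : IsMaxAntichain (· ≤ ·) A) : toggleCube F A = toggleCube (upperClosure A) A := by
  have hF := h.symmDiff_upperClosure_subset hA
  refine (h.toggleCube_subset_iff.2 ⟨subset_rfl, hF⟩).antisymm ?_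
  rw [symmDiff_comm] at hF
  exact (indepToggleable_upperClosure hA.1).toggleCube_subset_iff.2 ⟨subset_rfl, hF⟩

theorem IndepToggleable.insert_of_maximal (h : IndepToggleable F A) {p : P} (hpF : p ∉ F)
    (hp : Maximal (fun q => ∀ a ∈ A, IncompRel (· ≤ ·) a q) p) :
    IndepToggleable F (insert p A) := by
  rw [indepToggleable_iff] at h ⊢
  obtain ⟨hincomp, hmax⟩ := hp
  intro a b hab ha
  by_cases hap : a = p
  · subst hap
    have hbA : b ∉ A := fun hb => (hincomp b hb).2 hab.le
    obtain ⟨c, hc, hcb⟩ : ∃ c ∈ A, c ≤ b := by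
      by_contra! hcon
      exact hab.not_ge (hmax (fun c hc => ⟨hcon c hc, fun hbc =>
        (hincomp c hc).2 (hab.le.trans hbc)⟩) hab.le)
    have hbF := (h (hcb.lt_of_ne (ne_of_mem_of_not_mem hc hbA)) (Or.inr hc)).1
    exact ⟨hbF, fun hb => hb.elim (fun e => hpF (e ▸ hbF)) hbA⟩
  · have hb := h hab (by grind)
    exact ⟨hb.1, fun hb' => hb'.elim (fun e => hpF (e ▸ hb.1)) hb.2⟩

theorem IndepToggleable.insert_of_minimal (h : IndepToggleable F A) {p : P}
    (hp : Minimal (fun q => q ∈ F ∧ ∀ a ∈ A, IncompRel (· ≤ ·) a q) p) :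
    IndepToggleable F (insert p A) := by
  rw [indepToggleable_iff] at h ⊢
  obtain ⟨⟨hpF, hincomp⟩, hmin⟩ := hp
  intro a b hab ha
  replace ha : a ∈ (F : Set P) ∪ A := by grind [SetLike.mem_coe]
  have hb := h hab ha
  refine ⟨hb.1, fun hb' => hb'.elim ?_ hb.2⟩
  rintro rfl
  have haA : a ∉ A := fun ha => (hincomp a ha).1 hab.le
  obtain ⟨c, hc, hac⟩ : ∃ c ∈ A, a ≤ c := by
    by_contra! hcon
    exact hab.not_ge (hmin ⟨ha.resolve_right haA, fun c hc =>
      ⟨fun hca => (hincomp c hc).1 (hca.trans hab.le), hcon c hc⟩⟩ hab.le)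
  exact (h (hac.lt_of_ne (ne_of_mem_of_not_mem hc haA).symm) ha).2 hc

theorem IndepToggleable.exists_insert [Finite P] (h : IndepToggleable F A)
    (hA : ¬ IsMaxAntichain (· ≤ ·) A) : ∃ p ∉ A, IndepToggleable F (insert p A) := by
  let I : Set P := {p | ∀ a ∈ A, IncompRel (· ≤ ·) a p}
  have hIA {p} (hp : p ∈ I) : p ∉ A := fun hpA => (hp p hpA).1 le_rfl
  have hI : I.Nonempty := by
    by_contra! hempty
    refine hA (isMaxAntichain_iff.2 ⟨h.isAntichain, fun p _ => by_contra fun hcon => ?_⟩)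
    push Not at hcon
    exact hempty.subset hcon
  rcases ((F : Set P) ∩ I).eq_empty_or_nonempty with hFI | hFI
  · obtain ⟨p, hp⟩ := I.toFinite.exists_maximal hI
    exact ⟨p, hIA hp.1, h.insert_of_maximal (fun hpF => hFI.subset ⟨hpF, hp.1⟩) hp⟩
  · obtain ⟨p, hp⟩ := ((F : Set P) ∩ I).toFinite.exists_minimal hFI
    exact ⟨p, hIA hp.1.2, h.insert_of_minimal hp⟩

theorem inducesMaximalCube_filterCube_iff [Finite P] {S : Set (UpperSet P)} :
    InducesMaximalCube (filterCube P) k S ↔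
      ∃ A, IsMaxAntichain (· ≤ ·) A ∧ A.ncard = k ∧ toggleCube (upperClosure A) A = S := by
  constructor
  · rintro ⟨hS, hmax⟩
    obtain ⟨F, A, h, hk, rfl⟩ := inducesCube_filterCube_iff.1 hS
    have hA : IsMaxAntichain (· ≤ ·) A := by
      by_contra hA
      obtain ⟨p, hp, h'⟩ := h.exists_insert hA
      have hsub : toggleCube F A ⊆ toggleCube F (insert p A) :=
        fun G hG => hG.trans (Set.subset_insert p A)
      have heq := hmax _ _ (h'.inducesCube rfl) hsub
      exact hp ((h'.toggleCube_subset_iff.1 heq.subset).1 (Set.mem_insert p A))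
    exact ⟨A, hA, hk, (h.toggleCube_eq hA).symm⟩
  · rintro ⟨A, hA, hk, rfl⟩
    have h := indepToggleable_upperClosure hA.1
    refine ⟨h.inducesCube hk, fun m T hT hsub => ?_⟩
    obtain ⟨G, B, hB, -, rfl⟩ := inducesCube_filterCube_iff.1 hT
    obtain ⟨hAB, hdiff⟩ := h.toggleCube_subset_iff.1 hsub
    obtain rfl := hA.2 hB.isAntichain hAB
    rw [symmDiff_comm] at hdiff
    exact (hB.toggleCube_subset_iff.2 ⟨subset_rfl, hdiff⟩).antisymm hsub

theorem numMaximalCubes_filterCube [Finite P] : numMaximalCubes (filterCube P) k =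
    {A : Set P | IsMaxAntichain (· ≤ ·) A ∧ A.ncard = k}.ncard := by
  have himage : {S | InducesMaximalCube (filterCube P) k S} =
      (fun A => toggleCube (upperClosure A) A) ''
        {A : Set P | IsMaxAntichain (· ≤ ·) A ∧ A.ncard = k} := by
    ext S
    simp only [Set.mem_ofPred_eq, inducesMaximalCube_filterCube_iff, Set.mem_image, and_assoc]
  rw [numMaximalCubes, himage]
  refine Set.InjOn.ncard_image fun A hA B hB hAB => ?_
  exact ((indepToggleable_upperClosure hA.1.1).toggleCube_subset_iff.1 hAB.subset).1.antisymm
    ((indepToggleable_upperClosure hB.1.1).toggleCube_subset_iff.1 hAB.superset).1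

end Toggling

theorem coeff_maximalCubePoly {V : Type*} [Finite V] (G : SimpleGraph V) (k : ℕ) :
    (maximalCubePoly G).coeff k = numMaximalCubes G k := by
  have hfinite : {m | numMaximalCubes G m ≠ 0}.Finite := by
    refine (Set.finite_range fun S : Set V => Nat.log 2 S.ncard).subset fun m hm => ?_
    obtain ⟨S, hS, -⟩ := Set.nonempty_of_ncard_ne_zero hm
    exact ⟨S, by simp [hS.ncard_eq]⟩
  have hsupport : Function.HasFiniteSupport fun m =>
      Polynomial.C (numMaximalCubes G m : ℤ) * Polynomial.X ^ m :=
    hfinite.subset fun m hm h => hm (by simp [h])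
  have hcoeff := (Polynomial.lcoeff ℤ k).toAddMonoidHom.map_finsum hsupport
  refine hcoeff.trans ((finsum_eq_single _ k fun m hm => ?_).trans ?_)
  · simp [Polynomial.coeff_X_pow, hm.symm]
  · simp

/-! ### Maximal independent sets -/

section MaximalIndependentSets

open Finset

variable {V : Type*} {G : SimpleGraph V} {s A : Finset V} {u v : V}

open Classical in
/-- The maximal independent sets of the subgraph of `G` induced by `s`. Maximality is expressed as
domination: every other vertex of `s` has a neighbour in the set. -/
noncomputable def maximalIndepSets (G : SimpleGraph V) (s : Finset V) : Finset (Finset V) :=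
  {A ∈ s.powerset | G.IsIndepSet A ∧ ∀ v ∈ s, v ∉ A → ∃ u ∈ A, G.Adj u v}

/-- The generating polynomial of the maximal independent sets of the subgraph of `G` induced by
`s`, counted by size. -/
noncomputable def maximalIndepPoly (G : SimpleGraph V) (s : Finset V) : Polynomial ℤ :=
  ∑ A ∈ maximalIndepSets G s, Polynomial.X ^ #A

/-- The closed neighbourhood of `v` in the subgraph of `G` induced by `s`. -/
def closedNbhd [DecidableEq V] (G : SimpleGraph V) [DecidableRel G.Adj] (s : Finset V) (v : V) :
    Finset V :=
  {u ∈ s | u = v ∨ G.Adj v u}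

theorem mem_maximalIndepSets : A ∈ maximalIndepSets G s ↔
    A ⊆ s ∧ (∀ u ∈ A, ∀ v ∈ A, ¬ G.Adj u v) ∧ ∀ v ∈ s, v ∉ A → ∃ u ∈ A, G.Adj u v := by
  have hindep : G.IsIndepSet A ↔ ∀ u ∈ A, ∀ v ∈ A, ¬ G.Adj u v :=
    ⟨fun h u hu v hv huv => h hu hv huv.ne huv, fun h u hu v hv _ => h u hu v hv⟩
  simp [maximalIndepSets, hindep]

theorem coeff_maximalIndepPoly (k : ℕ) :
    (maximalIndepPoly G s).coeff k = #{A ∈ maximalIndepSets G s | #A = k} := by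
  simp [maximalIndepPoly, Polynomial.coeff_X_pow, eq_comm]

theorem maximalIndepPoly_empty : maximalIndepPoly G ∅ = 1 := by
  have : maximalIndepSets G ∅ = {∅} := by
    ext A
    simp +contextual [mem_maximalIndepSets]
  simp [maximalIndepPoly, this]

section Recurrence

variable [DecidableEq V] [DecidableRel G.Adj]

theorem mem_closedNbhd : u ∈ closedNbhd G s v ↔ u ∈ s ∧ (u = v ∨ G.Adj v u) := by
  simp [closedNbhd]

theorem mem_maximalIndepSets_sdiff_closedNbhd_iff (hu : u ∈ s) :
    A ∈ maximalIndepSets G (s \ closedNbhd G s u) ↔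
      u ∉ A ∧ insert u A ∈ maximalIndepSets G s := by
  have hsymm (v : V) : G.Adj v u ↔ G.Adj u v := G.adj_comm v u
  simp only [mem_maximalIndepSets, mem_sdiff, mem_closedNbhd, mem_insert, subset_iff]
  constructor
  · rintro ⟨hsub, hindep, hdom⟩
    refine ⟨by grind, by grind, ?_, by grind⟩
    rintro v (rfl | hv) w (rfl | hw) <;> grind [G.irrefl]
  · rintro ⟨huA, hsub, hindep, hdom⟩
    exact ⟨by grind, by grind, by grind⟩

theorem maximalIndepSets_eq_biUnion (hv : v ∈ s) :
    maximalIndepSets G s = (closedNbhd G s v).biUnion fun u =>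
      (maximalIndepSets G (s \ closedNbhd G s u)).image (insert u) := by
  ext A
  simp only [mem_biUnion, mem_image]
  constructor
  · intro hA
    obtain ⟨u, huA, huv⟩ : ∃ u ∈ A, u ∈ closedNbhd G s v := by
      by_contra! hcon
      obtain ⟨hAs, -, hdom⟩ := mem_maximalIndepSets.1 hA
      obtain ⟨u, hu, huv⟩ := hdom v hv fun h => hcon v h (mem_closedNbhd.2 ⟨hv, Or.inl rfl⟩)
      exact hcon u hu (mem_closedNbhd.2 ⟨hAs hu, Or.inr huv.symm⟩)
    refine ⟨u, huv, A.erase u, ?_, insert_erase huA⟩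
    rw [mem_maximalIndepSets_sdiff_closedNbhd_iff (mem_closedNbhd.1 huv).1, insert_erase huA]
    exact ⟨notMem_erase u A, hA⟩
  · rintro ⟨u, huv, B, hB, rfl⟩
    exact ((mem_maximalIndepSets_sdiff_closedNbhd_iff (mem_closedNbhd.1 huv).1).1 hB).2

theorem maximalIndepPoly_eq_X_mul_sum (hv : v ∈ s) (hclique : G.IsClique (closedNbhd G s v)) :
    maximalIndepPoly G s =
      Polynomial.X * ∑ u ∈ closedNbhd G s v, maximalIndepPoly G (s \ closedNbhd G s u) := by
  have hmem {u} (hu : u ∈ closedNbhd G s v) {A} :=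
    mem_maximalIndepSets_sdiff_closedNbhd_iff (G := G) (A := A) (mem_closedNbhd.1 hu).1
  have hdisj : (closedNbhd G s v : Set V).PairwiseDisjoint fun u =>
      (maximalIndepSets G (s \ closedNbhd G s u)).image (insert u) := by
    intro u hu w hw huw
    refine disjoint_left.2 fun A hAu hAw => ?_
    obtain ⟨B, hB, rfl⟩ := mem_image.1 hAu
    obtain ⟨C, -, hC⟩ := mem_image.1 hAw
    exact (mem_maximalIndepSets.1 ((hmem hu).1 hB).2).2.1 u (mem_insert_self u B) w
      (hC ▸ mem_insert_self w C) (hclique hu hw huw)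
  rw [maximalIndepPoly, maximalIndepSets_eq_biUnion hv, sum_biUnion hdisj, mul_sum]
  refine sum_congr rfl fun u hu => ?_
  have hinj : Set.InjOn (insert u) (maximalIndepSets G (s \ closedNbhd G s u) : Set (Finset V)) :=
    fun A hA B hB hAB => by
      rw [← erase_insert ((hmem hu).1 hA).1, hAB, erase_insert ((hmem hu).1 hB).1]
  rw [sum_image hinj, maximalIndepPoly, mul_sum]
  refine sum_congr rfl fun A hA => ?_
  rw [card_insert_of_notMem ((hmem hu).1 hA).1, pow_succ']

end Recurrence

theorem maximalIndepPoly_of_isClique (hs : s.Nonempty) (hclique : G.IsClique s) :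
    maximalIndepPoly G s = (#s : Polynomial ℤ) * Polynomial.X := by
  classical
  have hnbhd {v : V} (hv : v ∈ s) : closedNbhd G s v = s :=
    filter_true_of_mem fun u hu => (eq_or_ne u v).imp_right fun h => hclique hv hu h.symm
  obtain ⟨v, hv⟩ := hs
  rw [maximalIndepPoly_eq_X_mul_sum hv (by rwa [hnbhd hv]), hnbhd hv,
    sum_congr rfl fun u hu => by rw [hnbhd hu, sdiff_self, bot_eq_empty, maximalIndepPoly_empty],
    sum_const, nsmul_one, mul_comm]

variable {P : Type*} {r : P → P → Prop} {H : SimpleGraph V}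

theorem isMaxAntichain_preimage_iff (φ : SimpleGraph.fromRel r ↪g H) (hφ : Set.range φ = s)
    (hA : A ⊆ s) : IsMaxAntichain r (φ ⁻¹' A) ↔ A ∈ maximalIndepSets H s := by
  have hadj (p q : P) : H.Adj (φ p) (φ q) ↔ p ≠ q ∧ (r p q ∨ r q p) := by
    rw [φ.map_adj_iff, SimpleGraph.fromRel_adj]
  have hs (v : V) : v ∈ s ↔ ∃ p, φ p = v := by rw [← mem_coe, ← hφ, Set.mem_range]
  rw [isMaxAntichain_iff, mem_maximalIndepSets]
  constructor
  · rintro ⟨hanti, hmax⟩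
    refine ⟨hA, fun u hu v hv huv => ?_, fun v hv hvA => ?_⟩
    · obtain ⟨p, rfl⟩ := (hs u).1 (hA hu)
      obtain ⟨q, rfl⟩ := (hs v).1 (hA hv)
      obtain ⟨hpq, h | h⟩ := (hadj p q).1 huv
      · exact hanti hu hv hpq h
      · exact hanti hv hu hpq.symm h
    · obtain ⟨p, rfl⟩ := (hs v).1 hv
      obtain ⟨a, ha, hap⟩ := hmax p hvA
      exact ⟨φ a, ha, (hadj a p).2 ⟨fun h => hvA (h ▸ ha), hap⟩⟩
  · rintro ⟨-, hindep, hdom⟩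
    refine ⟨fun p hp q hq hpq h => hindep _ hp _ hq ((hadj p q).2 ⟨hpq, Or.inl h⟩),
      fun p hp => ?_⟩
    obtain ⟨u, hu, hup⟩ := hdom (φ p) ((hs _).2 ⟨p, rfl⟩) hp
    obtain ⟨a, rfl⟩ := (hs u).1 (hA hu)
    exact ⟨a, hu, ((hadj a p).1 hup).2⟩

theorem ncard_isMaxAntichain (φ : SimpleGraph.fromRel r ↪g H) (hφ : Set.range φ = s) (k : ℕ) :
    ({A : Set P | IsMaxAntichain r A ∧ A.ncard = k}.ncard : ℤ) =
      (maximalIndepPoly H s).coeff k := by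
  classical
  have hcard {A : Finset V} (hA : A ⊆ s) : (φ ⁻¹' (A : Set V)).ncard = #A := by
    rw [Set.ncard_preimage_of_injective_subset_range φ.injective (by rwa [hφ, coe_subset]),
      Set.ncard_coe_finset]
  have himage : {A : Set P | IsMaxAntichain r A ∧ A.ncard = k} =
      (fun A : Finset V => φ ⁻¹' (A : Set V)) ''
        ({A ∈ maximalIndepSets H s | #A = k} : Finset (Finset V)) := by
    ext A
    simp only [Set.mem_image, coe_filter, Set.mem_ofPred_eq]
    constructor
    · rintro ⟨hA, hk⟩
      have hfin : (φ '' A).Finite := s.finite_toSet.subset (hφ ▸ Set.image_subset_range φ A)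
      have hsub : hfin.toFinset ⊆ s := by
        rw [← coe_subset, hfin.coe_toFinset, ← hφ]
        exact Set.image_subset_range φ A
      have hpre : φ ⁻¹' (hfin.toFinset : Set V) = A := by
        rw [hfin.coe_toFinset, Set.preimage_image_eq A φ.injective]
      exact ⟨hfin.toFinset, ⟨(isMaxAntichain_preimage_iff φ hφ hsub).1 (hpre.symm ▸ hA),
        by rw [← hcard hsub, hpre, hk]⟩, hpre⟩
    · rintro ⟨B, ⟨hB, hk⟩, rfl⟩
      have hsub := (mem_maximalIndepSets.1 hB).1
      exact ⟨(isMaxAntichain_preimage_iff φ hφ hsub).2 hB, (hcard hsub).trans hk⟩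
  rw [himage, Set.InjOn.ncard_image, Set.ncard_coe_finset, coeff_maximalIndepPoly]
  intro A hA B hB hAB
  have hrange {C : Finset V} (hC : C ∈ ({A ∈ maximalIndepSets H s | #A = k} : Finset _)) :
      (C : Set V) ⊆ Set.range φ := by
    rw [hφ]
    exact (mem_maximalIndepSets.1 (mem_filter.1 hC).1).1
  exact coe_injective ((Set.preimage_eq_preimage' (hrange hA) (hrange hB)).1 hAB)

theorem maximalCubePoly_filterCube [PartialOrder P] [Finite P]
    (φ : SimpleGraph.fromRel (V := P) (· ≤ ·) ↪g H) (hφ : Set.range φ = s) :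
    maximalCubePoly (filterCube P) = maximalIndepPoly H s := by
  ext k
  rw [coeff_maximalCubePoly, numMaximalCubes_filterCube, ncard_isMaxAntichain φ hφ]

end MaximalIndependentSets

/-! ### The comparability graph of an L-fence -/

/-- The comparability graph of the infinite fence `x₀ > x₁ > x₂ < x₃ > x₄ < ⋯`: a path with the
additional edge `x₀x₂`. -/
def fenceGraph : SimpleGraph ℕ where
  Adj i j := i + 1 = j ∨ j + 1 = i ∨ (i = 0 ∧ j = 2) ∨ (i = 2 ∧ j = 0)
  symm := ⟨fun i j => by omega⟩
  loopless := ⟨fun i => by omega⟩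

theorem fenceGraph_adj {i j : ℕ} : fenceGraph.Adj i j ↔
    i + 1 = j ∨ j + 1 = i ∨ (i = 0 ∧ j = 2) ∨ (i = 2 ∧ j = 0) :=
  Iff.rfl

instance : DecidableRel fenceGraph.Adj := fun _ _ => decidable_of_iff' _ fenceGraph_adj

/-- The generating polynomial of the maximal independent sets of the comparability graph of the
L-fence with `n` elements. -/
noncomputable def fencePoly (n : ℕ) : Polynomial ℤ :=
  maximalIndepPoly fenceGraph (Finset.range n)

theorem fencePoly_zero : fencePoly 0 = 1 :=
  maximalIndepPoly_empty

theorem fencePoly_of_le_three {n : ℕ} (h0 : n ≠ 0) (h3 : n ≤ 3) :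
    fencePoly n = (n : Polynomial ℤ) * Polynomial.X := by
  have hclique : fenceGraph.IsClique (Finset.range n) := fun i hi j hj hij => by
    rw [Finset.mem_coe, Finset.mem_range] at hi hj
    rw [fenceGraph_adj]
    omega
  rw [fencePoly, maximalIndepPoly_of_isClique (Finset.nonempty_range_iff.2 h0) hclique,
    Finset.card_range]

theorem closedNbhd_fenceGraph_last (n : ℕ) :
    closedNbhd fenceGraph (Finset.range (n + 4)) (n + 3) = {n + 2, n + 3} := by
  ext i
  simp only [mem_closedNbhd, fenceGraph_adj, Finset.mem_range, Finset.mem_insert,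
    Finset.mem_singleton]
  omega

theorem fencePoly_add_four (n : ℕ) : fencePoly (n + 4) = Polynomial.X *
    (fencePoly (n + 2) + maximalIndepPoly fenceGraph
      (Finset.range (n + 4) \ closedNbhd fenceGraph (Finset.range (n + 4)) (n + 2))) := by
  have hclique : fenceGraph.IsClique (closedNbhd fenceGraph (Finset.range (n + 4)) (n + 3)) := by
    simp [closedNbhd_fenceGraph_last, SimpleGraph.isClique_iff, fenceGraph_adj,
      Set.pairwise_insert]
  have hlast : Finset.range (n + 4) \ {n + 2, n + 3} = Finset.range (n + 2) := by
    ext i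
    simp only [Finset.mem_sdiff, Finset.mem_range, Finset.mem_insert, Finset.mem_singleton]
    omega
  rw [fencePoly, maximalIndepPoly_eq_X_mul_sum (Finset.mem_range.2 (by omega)) hclique,
    closedNbhd_fenceGraph_last, Finset.sum_pair (by omega), closedNbhd_fenceGraph_last, hlast,
    add_comm, ← fencePoly]

theorem fencePoly_four :
    fencePoly 4 = Polynomial.X * (fencePoly 2 + fencePoly 0) := by
  have hpenultimate : Finset.range 4 \ closedNbhd fenceGraph (Finset.range 4) 2 = ∅ := by decide
  rw [fencePoly_add_four 0, hpenultimate, fencePoly_zero, maximalIndepPoly_empty]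

theorem fencePoly_add_five (n : ℕ) :
    fencePoly (n + 5) = Polynomial.X * (fencePoly (n + 3) + fencePoly (n + 2)) := by
  have hpenultimate : Finset.range (n + 5) \
      closedNbhd fenceGraph (Finset.range (n + 5)) (n + 3) = Finset.range (n + 2) := by
    ext i
    simp only [Finset.mem_sdiff, mem_closedNbhd, fenceGraph_adj, Finset.mem_range]
    omega
  rw [fencePoly_add_four (n + 1), hpenultimate, ← fencePoly]

/-! ### Orientation of lucasenes -/

theorem hexArc_iff_not_hexArc_of_hexAdj {c d : ℤ × ℤ} (h : HexAdj c d) :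
    HexArc c d ↔ ¬ HexArc d c := by
  rw [hexAdj_iff] at h
  rw [hexArc_iff, hexArc_iff]
  omega

theorem HexArc.hexAdj {c d : ℤ × ℤ} : HexArc c d → HexAdj c d
  | ⟨i, _, h⟩ => ⟨i, h⟩

theorem hexArc_iff_hexArc_iff_sub_eq_sub {a b c : ℤ × ℤ} (hab : HexAdj a b) (hbc : HexAdj b c)
    (hac : ¬ HexAdj a c) (hne : a ≠ c) :
    (HexArc b c ↔ HexArc a b) ↔ c - b = b - a := by
  rw [hexAdj_iff] at hab hbc hac
  rw [hexArc_iff, hexArc_iff]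
  rw [Ne, Prod.ext_iff] at hne
  simp only [Prod.ext_iff, Prod.fst_sub, Prod.snd_sub]
  rcases hab with ⟨h1, h2⟩ | ⟨h1, h2⟩ | ⟨h1, h2⟩ | ⟨h1, h2⟩ | ⟨h1, h2⟩ | ⟨h1, h2⟩ <;>
  rcases hbc with ⟨h3, h4⟩ | ⟨h3, h4⟩ | ⟨h3, h4⟩ | ⟨h3, h4⟩ | ⟨h3, h4⟩ | ⟨h3, h4⟩ <;>
  omega

theorem fenceHeight_succ_lt_iff (i : ℕ) :
    fenceHeight (i + 1) < fenceHeight i ↔ ¬ fenceHeight i < fenceHeight (i + 1) := by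
  grind [fenceHeight]

theorem fenceHeight_linear_iff (i : ℕ) :
    (fenceHeight (i + 2) < fenceHeight (i + 1) ↔ fenceHeight (i + 1) < fenceHeight i) ↔
      i = 0 := by
  grind [fenceHeight]

namespace IsLucasene

variable {n : ℕ} {c : Fin n → ℤ × ℤ}

theorem hexArc_succ_iff (hc : IsLucasene c) (i : ℕ) (hi : i + 1 < n) :
    HexArc (c ⟨i, by omega⟩) (c ⟨i + 1, hi⟩) ↔
      (fenceHeight (i + 1) < fenceHeight i ↔ HexArc (c ⟨0, by omega⟩) (c ⟨1, by omega⟩)) := by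
  induction i with
  | zero => simp [fenceHeight]
  | succ i ih =>
    have hturn : (HexArc (c ⟨i + 1, by omega⟩) (c ⟨i + 2, hi⟩) ↔
        HexArc (c ⟨i, by omega⟩) (c ⟨i + 1, by omega⟩)) ↔ i = 0 := by
      rw [hexArc_iff_hexArc_iff_sub_eq_sub ((hc.adj_iff _ _).2 (Or.inl rfl))
        ((hc.adj_iff _ _).2 (Or.inl rfl)), hc.linear_iff _ _ _ rfl rfl]
      · rw [hc.adj_iff]
        simp only
        omega
      · exact hc.injective.ne (by simp)
    have hheight := fenceHeight_linear_iff i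
    have := ih (by omega)
    tauto

theorem exists_hexArc_iff (hc : IsLucasene c) : ∃ D : Prop, ∀ i j, HexArc (c i) (c j) ↔
    ((i : ℕ) + 1 = j ∨ (j : ℕ) + 1 = i) ∧ (fenceHeight j < fenceHeight i ↔ D) := by
  have hadj {i j} (h : HexArc (c i) (c j)) := (hc.adj_iff i j).1 h.hexAdj
  rcases le_or_gt n 1 with hn | hn
  · exact ⟨True, fun i j => ⟨fun h => absurd (hadj h) (by omega), fun h => by omega⟩⟩
  refine ⟨HexArc (c ⟨0, by omega⟩) (c ⟨1, by omega⟩), fun i j => ?_⟩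
  refine (and_iff_right_of_imp hadj).symm.trans (and_congr_right fun hij => ?_)
  obtain ⟨i, hi⟩ := i
  obtain ⟨j, hj⟩ := j
  obtain rfl | rfl : i + 1 = j ∨ j + 1 = i := hij
  · exact hc.hexArc_succ_iff i hj
  · rw [hexArc_iff_not_hexArc_of_hexAdj ((hc.adj_iff _ _).2 (Or.inr rfl)),
      hc.hexArc_succ_iff j]
    have := fenceHeight_succ_lt_iff j
    tauto

theorem hexArc_iff_covBy (hc : IsLucasene c) :
    (∀ i j, HexArc (c i) (c j) ↔ StdFence.mk j ⋖ StdFence.mk i) ∨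
      ∀ i j, HexArc (c i) (c j) ↔ StdFence.mk i ⋖ StdFence.mk j := by
  obtain ⟨D, hD⟩ := hc.exists_hexArc_iff
  simp only [hD, StdFence.covBy_iff]
  by_cases hD' : D
  · exact Or.inl fun i j => by rw [iff_true_right hD', and_comm, or_comm]
  · refine Or.inr fun i j => ?_
    have := fenceHeight_succ_lt_iff i
    have := fenceHeight_succ_lt_iff j
    rw [iff_false_right hD', and_comm]
    refine and_congr_left fun hij => ?_
    grind

end IsLucasene

/-! ### L-fences -/

theorem nonempty_orderIso_of_covBy_iff {P Q : Type*} [PartialOrder P] [PartialOrder Q] [Finite P]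
    (e : P ≃ Q) (h : ∀ a b, a ⋖ b ↔ e a ⋖ e b) : Nonempty (P ≃o Q) := by
  classical
  have := Fintype.ofFinite P
  have := Fintype.ofEquiv P e
  let _ : LocallyFiniteOrder P := Fintype.toLocallyFiniteOrder
  let _ : LocallyFiniteOrder Q := Fintype.toLocallyFiniteOrder
  refine ⟨e.toOrderIso ((monotone_iff_forall_covBy e).2 fun a b hab => ((h a b).1 hab).le)
    ((monotone_iff_forall_covBy e.symm).2 fun a b hab => ((h _ _).2 ?_).le)⟩
  simpa only [e.apply_symm_apply] using hab

theorem StdFence.fenceGraph_adj_iff {n : ℕ} (a b : StdFence n) :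
    fenceGraph.Adj a.idx b.idx ↔ a < b ∨ b < a := by
  rw [StdFence.lt_iff, StdFence.lt_iff, fenceGraph_adj]
  simp only [fenceHeight]
  split_ifs <;> omega

namespace IsLFence

variable {n : ℕ} {P : Type*} [PartialOrder P]

theorem finite (h : IsLFence n P) : Finite P :=
  let ⟨_, e, _⟩ := h
  Finite.of_equiv _ e.symm

theorem nonempty_orderIso_stdFence (h : IsLFence n P) :
    Nonempty (P ≃o StdFence n) ∨ Nonempty (P ≃o (StdFence n)ᵒᵈ) := by
  have := h.finite
  obtain ⟨c, e, hc, he⟩ := h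
  let idx : P ≃ StdFence n := e.trans ⟨StdFence.mk, StdFence.idx, fun _ => rfl, fun _ => rfl⟩
  rcases hc.hexArc_iff_covBy with hcov | hcov
  · exact Or.inl (nonempty_orderIso_of_covBy_iff idx fun a b => by rw [he, hcov]; rfl)
  · refine Or.inr (nonempty_orderIso_of_covBy_iff (idx.trans OrderDual.toDual) fun a b => ?_)
    rw [he, hcov]
    exact toDual_covBy_toDual_iff.symm

theorem exists_embedding_fenceGraph (h : IsLFence n P) :
    ∃ φ : SimpleGraph.fromRel (V := P) (· ≤ ·) ↪g fenceGraph, Set.range φ = Finset.range n := by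
  obtain ⟨e, he⟩ : ∃ e : P ≃ Fin n, ∀ a b, fenceGraph.Adj (e a) (e b) ↔ a < b ∨ b < a := by
    let idx : StdFence n ≃ Fin n := ⟨StdFence.idx, StdFence.mk, fun _ => rfl, fun _ => rfl⟩
    rcases h.nonempty_orderIso_stdFence with ⟨⟨e⟩⟩ | ⟨⟨e⟩⟩
    · refine ⟨e.toEquiv.trans idx, fun a b => ?_⟩
      rw [← e.lt_iff_lt, ← e.lt_iff_lt]
      exact StdFence.fenceGraph_adj_iff _ _
    · refine ⟨(e.toEquiv.trans OrderDual.ofDual).trans idx, fun a b => ?_⟩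
      rw [← e.lt_iff_lt, ← e.lt_iff_lt, or_comm]
      exact StdFence.fenceGraph_adj_iff _ _
  refine ⟨⟨e.toEmbedding.trans Fin.valEmbedding, fun {a b} => ?_⟩, ?_⟩
  · refine (he a b).trans ?_
    rw [SimpleGraph.fromRel_adj, lt_iff_le_and_ne, lt_iff_le_and_ne, ne_comm (a := b)]
    tauto
  · change Set.range (Fin.val ∘ e) = _
    rw [e.surjective.range_comp, Fin.range_val, Finset.coe_range]

theorem maximalCubePoly_eq (h : IsLFence n P) : maximalCubePoly (filterCube P) = fencePoly n := by
  have := h.finite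
  obtain ⟨φ, hφ⟩ := h.exists_embedding_fenceGraph
  exact maximalCubePoly_filterCube φ hφ

end IsLFence

theorem IsLFence.coe_numMaximalCubes_eq_coeff {n : ℕ} {P : Type*} [PartialOrder P]
    (h : IsLFence n P) (k : ℕ) :
    (numMaximalCubes (filterCube P) k : ℤ) = (fencePoly n).coeff k := by
  have := h.finite
  rw [← h.maximalCubePoly_eq, coeff_maximalCubePoly]

/-! ### Generating functions -/

section GeneratingFunctions

open PowerSeries

theorem mk_eq_of_padovan_recurrence {R : Type*} [CommRing R] {r : R} {a : ℕ → R}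
    (ha : ∀ n, a (n + 3) = r * (a (n + 1) + a n)) :
    mk a = (C (a 0) + C (a 1) * X + C (a 2 - r * a 0) * X ^ 2) *
      invOfUnit (1 - C r * X ^ 2 * (1 + X)) 1 := by
  have hmul : mk a * (1 - C r * X ^ 2 * (1 + X)) =
      C (a 0) + C (a 1) * X + C (a 2 - r * a 0) * X ^ 2 := by
    have hexpand : mk a * (1 - C r * X ^ 2 * (1 + X)) =
        mk a - C r * (mk a * X ^ 2) - C r * (mk a * X ^ 3) := by ring
    rw [hexpand]
    ext n
    simp only [map_sub, map_add, coeff_C_mul, coeff_mul_X_pow', coeff_mk, coeff_C, coeff_X]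
    match n with
    | 0 | 1 | 2 => simp
    | n + 3 =>
      have hshift : n + 3 - 2 = n + 1 := rfl
      simp [ha, hshift, mul_add]
  rw [← hmul, mul_assoc, mul_invOfUnit _ _ (by simp), mul_one]

theorem mk_fencePoly : mk fencePoly = (2 + X) *
    invOfUnit (1 - C Polynomial.X * X ^ 2 * (1 + X)) 1 - (1 - C Polynomial.X) * X - 1 := by
  -- The corrections at `0` and `1` make the recurrence `a (n + 3) = X * (a (n + 1) + a n)` hold for
  -- all `n`.
  let a (n : ℕ) : Polynomial ℤ :=
    fencePoly n + if n = 0 then 1 else if n = 1 then 1 - Polynomial.X else 0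
  have h1 : fencePoly 1 = Polynomial.X := by simp [fencePoly_of_le_three]
  have h2 : fencePoly 2 = 2 * Polynomial.X := by simp [fencePoly_of_le_three]
  have h3 : fencePoly 3 = 3 * Polynomial.X := by simp [fencePoly_of_le_three]
  have ha : ∀ n, a (n + 3) = Polynomial.X * (a (n + 1) + a n)
    | 0 => by norm_num [a, fencePoly_zero, h1, h3, mul_comm]
    | 1 => by simp [a, fencePoly_four, fencePoly_zero, h1, h2]
    | n + 2 => by simp [a, fencePoly_add_five]
  have ha0 : a 0 = 2 := by simp [a, fencePoly_zero, one_add_one_eq_two]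
  have ha1 : a 1 = 1 := by simp [a, h1]
  have ha2 : a 2 - Polynomial.X * 2 = 0 := by simp [a, h2, mul_comm]
  have hmk : mk fencePoly = mk a - C (1 - Polynomial.X) * X - 1 := by
    ext1 n
    match n with
    | 0 | 1 | n + 2 => simp [a, coeff_one]
  have hC2 : (C 2 : (Polynomial ℤ)⟦X⟧) = 2 := map_ofNat C 2
  rw [hmk, mk_eq_of_padovan_recurrence ha, ha0, ha1, ha2, hC2]
  simp

theorem mk_padovan123 : mk (fun n => (padovan123 n : ℤ)) =
    (1 + 2 * X + 2 * X ^ 2) * invOfUnit (1 - X ^ 2 - X ^ 3) 1 := by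
  have hrec (n : ℕ) : (padovan123 (n + 3) : ℤ) = 1 * (padovan123 (n + 1) + padovan123 n) := by
    simp [padovan123]
  have hdenom : (1 - C 1 * X ^ 2 * (1 + X) : ℤ⟦X⟧) = 1 - X ^ 2 - X ^ 3 := by
    rw [map_one]
    ring
  rw [mk_eq_of_padovan_recurrence hrec, hdenom]
  simp [padovan123]

end GeneratingFunctions

theorem mainTheorem8 (Ξ : ℕ → Type*) [∀ n, PartialOrder (Ξ n)]
    (hΞ : ∀ n, IsLFence n (Ξ n)) :
    -- the recurrence for `h_{n,k}` (with `h_{n,-1} = 0`)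
    (∀ n : ℕ, 5 ≤ n →
      numMaximalCubes (filterCube (Ξ n)) 0 = 0 ∧
      ∀ k : ℕ, numMaximalCubes (filterCube (Ξ n)) (k + 1) =
        numMaximalCubes (filterCube (Ξ (n - 2))) k +
          numMaximalCubes (filterCube (Ξ (n - 3))) k) ∧
    -- the generating function of `H_n(x)`, in `ℤ[x]⟦y⟧`
    (PowerSeries.mk (fun n => maximalCubePoly (filterCube (Ξ n))) =
      (2 + PowerSeries.X) *
          PowerSeries.invOfUnit
            (1 - PowerSeries.C Polynomial.X * PowerSeries.X ^ 2 * (1 + PowerSeries.X)) 1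
        - (1 - PowerSeries.C Polynomial.X) * PowerSeries.X - 1) ∧
    -- the generating function of the `(1,2,3)`-Padovan numbers, in `ℤ⟦y⟧`
    (PowerSeries.mk (fun n => (padovan123 n : ℤ)) =
      (1 + 2 * PowerSeries.X + 2 * PowerSeries.X ^ 2) *
        PowerSeries.invOfUnit (1 - PowerSeries.X ^ 2 - PowerSeries.X ^ 3) 1) := by
  refine ⟨fun n hn => ?_, ?_, mk_padovan123⟩
  · obtain ⟨m, rfl⟩ := Nat.exists_eq_add_of_le' hn
    have hrec := fencePoly_add_five m
    constructor
    · rw [← Nat.cast_inj (R := ℤ), (hΞ _).coe_numMaximalCubes_eq_coeff, hrec,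
        Polynomial.coeff_X_mul_zero, Nat.cast_zero]
    · intro k
      rw [← Nat.cast_inj (R := ℤ), Nat.cast_add]
      simp only [(hΞ _).coe_numMaximalCubes_eq_coeff]
      rw [hrec, Polynomial.coeff_X_mul, Polynomial.coeff_add]
      rfl
  · simp only [(hΞ _).maximalCubePoly_eq]
    exact mk_fencePoly
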